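/- A drawing of a graph in $\mathbb{R}^2$ maps the vertices to distinct points and each edge to a Jordan arc between its two endpoints that contains no other vertex; it is plane if no two edges intersect except at a common endpoint. A maximal planar graph on $n$ vertices is a planar graph (one that has a plane drawing) with $3n-6$ edges. A biarc diagram is a drawing in which all vertices lie on a horizontal line, the spine, and each edge is either a proper arc, that is, one halfcircle centered on the spine (above or below it), or a biarc, that is, a Jordan arc that is the union of two halfcircles centered on the spine, one above and one below it; biarcs need not be $x$-monotone. For every $i\in\mathbb{N}$ there is a maximal planar graph $G_i$ on $n_i=3i+8$ vertices that cannot be drawn as a plane biarc diagram using fewer than $(n_i-8)/3=i$ biarcs. -/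

import Mathlib

/-- The Euclidean plane. Coordinate `0` is horizontal, coordinate `1` is vertical. -/
abbrev Plane : Type := EuclideanSpace ℝ (Fin 2)

/-- `S` is a Jordan arc with endpoints `a` and `b`: the image of an injective path. -/
def IsJordanArc (a b : Plane) (S : Set Plane) : Prop :=
  ∃ γ : Path a b, Function.Injective γ ∧ Set.range γ = S

/-- A drawing of a graph in the plane: the vertices are distinct points, every edge is a Jordan
arc between its two endpoints, and this arc contains no other vertex.
The values of `arc` outside the edge set of `G` are irrelevant. -/
structure Drawing {V : Type*} (G : SimpleGraph V) where
  /-- the point representing a vertex -/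
  point : V → Plane
  /-- the arc representing an edge -/
  arc : Sym2 V → Set Plane
  point_injective : Function.Injective point
  arc_isJordanArc : ∀ u v : V, G.Adj u v → IsJordanArc (point u) (point v) (arc s(u, v))
  arc_avoids : ∀ u v w : V, G.Adj u v → w ≠ u → w ≠ v → point w ∉ arc s(u, v)

/-- A drawing is plane if no two edges intersect except at a common endpoint. -/
def Drawing.IsPlane {V : Type*} {G : SimpleGraph V} (D : Drawing G) : Prop :=
  ∀ e ∈ G.edgeSet, ∀ f ∈ G.edgeSet, e ≠ f →
    ∀ z ∈ D.arc e ∩ D.arc f, ∃ v : V, v ∈ e ∧ v ∈ f ∧ z = D.point v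

/-- A graph is planar if it has a plane drawing. -/
def IsPlanarGraph {V : Type*} (G : SimpleGraph V) : Prop :=
  ∃ D : Drawing G, D.IsPlane

/-- A maximal planar graph on `n` vertices is a planar graph with `3n - 6` edges. -/
def IsMaximalPlanar {V : Type*} (G : SimpleGraph V) : Prop :=
  IsPlanarGraph G ∧ G.edgeSet.ncard + 6 = 3 * Nat.card V

/-- The closed halfcircle above the spine (the horizontal axis), centered on the spine, with
endpoints `(p, 0)` and `(q, 0)`. -/
def upperHalfcircle (p q : ℝ) : Set Plane :=
  {z | 0 ≤ z 1 ∧ (z 0 - (p + q) / 2) ^ 2 + z 1 ^ 2 = ((q - p) / 2) ^ 2}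

/-- The closed halfcircle below the spine (the horizontal axis), centered on the spine, with
endpoints `(p, 0)` and `(q, 0)`. -/
def lowerHalfcircle (p q : ℝ) : Set Plane :=
  {z | z 1 ≤ 0 ∧ (z 0 - (p + q) / 2) ^ 2 + z 1 ^ 2 = ((q - p) / 2) ^ 2}

/-- `S` is a proper arc between the points `p` and `q` of the spine: one halfcircle. -/
def IsProperArc (p q : ℝ) (S : Set Plane) : Prop :=
  S = upperHalfcircle p q ∨ S = lowerHalfcircle p q

/-- `S` is a biarc between the points `p` and `q` of the spine: the union of two halfcircles,
one above and one below the spine, joined at a third point `x` of the spine. The point `x` may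
lie between `p` and `q` or not, so biarcs need not be monotone. -/
def IsBiarc (p q : ℝ) (S : Set Plane) : Prop :=
  ∃ x : ℝ, x ≠ p ∧ x ≠ q ∧
    (S = upperHalfcircle p x ∪ lowerHalfcircle x q ∨
      S = lowerHalfcircle p x ∪ upperHalfcircle x q)

/-- A biarc diagram: all vertices lie on the spine, every edge is a proper arc or a biarc. -/
def Drawing.IsBiarcDiagram {V : Type*} {G : SimpleGraph V} (D : Drawing G) : Prop :=
  (∀ v : V, D.point v 1 = 0) ∧
    ∀ u v : V, G.Adj u v →
      IsProperArc (D.point u 0) (D.point v 0) (D.arc s(u, v)) ∨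
        IsBiarc (D.point u 0) (D.point v 0) (D.arc s(u, v))

/-- The set of edges that are drawn as biarcs. -/
def Drawing.biarcs {V : Type*} {G : SimpleGraph V} (D : Drawing G) : Set (Sym2 V) :=
  {e | ∃ u v : V, G.Adj u v ∧ e = s(u, v) ∧ IsBiarc (D.point u 0) (D.point v 0) (D.arc e)}

/-! Start from a triangulation with `i + 4` vertices: two adjacent apexes and a path of `i + 2`
inner vertices, all joined to both apexes. Stack a vertex into each of its `2i + 4` faces, which
gives `3i + 8` vertices. The two vertices stacked next to the edge between the apexes prolong the
path at its ends; the others are the tips. No two vertices of the stacked set `S` can be joined by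
an additional edge without destroying planarity.

In a biarc diagram the edges meet the spine only at vertices and at the joints of biarcs. If `S` had
more vertices than there are other vertices and biarcs together, then two cyclically consecutive
points of `S` on the spine would have nothing between them (`exists_gap`). These could be joined by
an upper arc, along the gap or around the whole diagram, that crosses no independent edge, a
contradiction. Hence `2i + 4 ≤ (i + 4) + #biarcs` (`Drawing.IsPlane.card_le`).

Nonplanarity is used in a parity form that avoids the Jordan curve theorem. Disjoint halfcircles on
one side of the spine have non-interleaved endpoints, a condition modulo two. Reflecting the lower
part of an edge upwards changes the parity of its crossings only through the endpoints that it
sweeps over, so the condition on a pair of edges involves only their endpoints and one function per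
edge (`EvenPair`). It is additive under concatenation, hence passes from edges to paths. Summed over
the 15 independent pairs of edges of a complete graph on five vertices it yields `0 = 1`
(`not_evenPair_completeGraph`), and therefore also excludes such a graph as a minor
(`Obstruction.false`).

Planarity of the graph itself comes from an explicit straight-line drawing, where central projection
from an apex to the spine separates the edges. -/

/-! ### Halfcircles and their intersections. -/

theorem mem_upperHalfcircle_left (p q : ℝ) {z : Plane} (h0 : z 0 = p) (h1 : z 1 = 0) :
    z ∈ upperHalfcircle p q := by
  refine ⟨h1.ge, ?_⟩
  rw [h0, h1]; ring

theorem mem_upperHalfcircle_right (p q : ℝ) {z : Plane} (h0 : z 0 = q) (h1 : z 1 = 0) :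
    z ∈ upperHalfcircle p q := by
  refine ⟨h1.ge, ?_⟩
  rw [h0, h1]; ring

theorem mem_lowerHalfcircle_left (p q : ℝ) {z : Plane} (h0 : z 0 = p) (h1 : z 1 = 0) :
    z ∈ lowerHalfcircle p q := by
  refine ⟨h1.le, ?_⟩
  rw [h0, h1]; ring

theorem mem_lowerHalfcircle_right (p q : ℝ) {z : Plane} (h0 : z 0 = q) (h1 : z 1 = 0) :
    z ∈ lowerHalfcircle p q := by
  refine ⟨h1.le, ?_⟩
  rw [h0, h1]; ring

theorem upperHalfcircle_comm (p q : ℝ) : upperHalfcircle p q = upperHalfcircle q p := by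
  ext z; simp only [upperHalfcircle, Set.mem_ofPred_eq, add_comm p q]
  rw [show ((q - p) / 2) ^ 2 = ((p - q) / 2) ^ 2 by ring]

theorem lowerHalfcircle_comm (p q : ℝ) : lowerHalfcircle p q = lowerHalfcircle q p := by
  ext z; simp only [lowerHalfcircle, Set.mem_ofPred_eq, add_comm p q]
  rw [show ((q - p) / 2) ^ 2 = ((p - q) / 2) ^ 2 by ring]

theorem upperHalfcircle_self (p : ℝ) {z : Plane} (hz : z ∈ upperHalfcircle p p) :
    z 0 = p ∧ z 1 = 0 := by
  obtain ⟨-, h⟩ := hz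
  constructor <;> nlinarith [sq_nonneg (z 0 - (p + p) / 2), sq_nonneg (z 1)]

theorem lowerHalfcircle_self (p : ℝ) {z : Plane} (hz : z ∈ lowerHalfcircle p p) :
    z 0 = p ∧ z 1 = 0 := by
  obtain ⟨-, h⟩ := hz
  constructor <;> nlinarith [sq_nonneg (z 0 - (p + p) / 2), sq_nonneg (z 1)]

/-- Interleaved pairs of points span circles that meet. -/
theorem exists_circle_inter {a b c d : ℝ} (h1 : a < c) (h2 : c < b) (h3 : b < d) :
    ∃ x y : ℝ, 0 ≤ y ∧ (x - (a + b) / 2) ^ 2 + y ^ 2 = ((b - a) / 2) ^ 2 ∧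
      (x - (c + d) / 2) ^ 2 + y ^ 2 = ((d - c) / 2) ^ 2 := by
  have hs : 0 < c + d - a - b := by linarith
  -- The common point lies on the radical axis of the two circles; its height over the diameter `[a,
  -- b]` is given by Thales, `y² = (x - a)(b - x)`.
  set x := (c * d - a * b) / (c + d - a - b) with hx
  have hxe : x * (c + d - a - b) = c * d - a * b := by rw [hx]; field_simp
  have hxc : 0 ≤ x - c := by
    have : x - c = (c - a) * (b - c) / (c + d - a - b) := by rw [hx]; field_simp; ring
    rw [this]
    exact div_nonneg (mul_nonneg (by linarith) (by linarith)) hs.le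
  have hxb : 0 ≤ b - x := by
    have : b - x = (b - c) * (d - b) / (c + d - a - b) := by rw [hx]; field_simp; ring
    rw [this]
    exact div_nonneg (mul_nonneg (by linarith) (by linarith)) hs.le
  have hy : 0 ≤ (x - a) * (b - x) := mul_nonneg (by linarith) hxb
  refine ⟨x, Real.sqrt ((x - a) * (b - x)), Real.sqrt_nonneg _, ?_, ?_⟩
  · rw [Real.sq_sqrt hy]; ring
  · rw [Real.sq_sqrt hy]; linear_combination -hxe

/-! ### Crossing parities of halfcircles. -/

/-- Indicator modulo two of `a < z`. -/
noncomputable def leftOf (a z : ℝ) : ZMod 2 := if a < z then 1 else 0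

theorem leftOf_swap {a b : ℝ} (h : a ≠ b) : leftOf b a = 1 + leftOf a b := by
  unfold leftOf
  rcases lt_or_gt_of_ne h with h | h
  · rw [if_neg h.not_gt, if_pos h]; decide
  · rw [if_pos h, if_neg h.not_gt]; decide

/-- Two pairs of points that are not interleaved separate each other evenly. -/
theorem parity_of_not_interleaved {a b c d : ℝ} (hac : a ≠ c) (had : a ≠ d) (hbc : b ≠ c)
    (hbd : b ≠ d)
    (h : ∀ a' b' c' d' : ℝ, (a' = a ∧ b' = b ∨ a' = b ∧ b' = a) →
      (c' = c ∧ d' = d ∨ c' = d ∧ d' = c) → (¬ (a' < c' ∧ c' < b' ∧ b' < d') ∧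
        ¬ (c' < a' ∧ a' < d' ∧ d' < b'))) :
    leftOf a c + leftOf b c + leftOf a d + leftOf b d = 0 := by
  have h1 := h a b c d (by simp) (by simp)
  have h2 := h b a c d (by simp) (by simp)
  have h3 := h a b d c (by simp) (by simp)
  have h4 := h b a d c (by simp) (by simp)
  have e1 : (1 + 1 : ZMod 2) = 0 := by decide
  unfold leftOf
  split_ifs <;> first | (simp [e1]; done) | (exfalso; grind)

/-- A shared endpoint is a common point, and interleaved endpoints force one by
`exists_circle_inter`; so disjointness leaves only the non-interleaved configurations. -/
theorem parity_of_disjoint_upper {a b c d : ℝ}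
    (h : Disjoint (upperHalfcircle a b) (upperHalfcircle c d)) :
    leftOf a c + leftOf b c + leftOf a d + leftOf b d = 0 := by
  rw [Set.disjoint_left] at h
  apply parity_of_not_interleaved
  · rintro rfl
    exact h (a := !₂[a, 0]) (mem_upperHalfcircle_left _ _ rfl rfl)
      (mem_upperHalfcircle_left _ _ rfl rfl)
  · rintro rfl
    exact h (a := !₂[a, 0]) (mem_upperHalfcircle_left _ _ rfl rfl)
      (mem_upperHalfcircle_right _ _ rfl rfl)
  · rintro rfl
    exact h (a := !₂[b, 0]) (mem_upperHalfcircle_right _ _ rfl rfl)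
      (mem_upperHalfcircle_left _ _ rfl rfl)
  · rintro rfl
    exact h (a := !₂[b, 0]) (mem_upperHalfcircle_right _ _ rfl rfl)
      (mem_upperHalfcircle_right _ _ rfl rfl)
  · intro a' b' c' d' h1 h2
    have e1 : upperHalfcircle a b = upperHalfcircle a' b' := by
      rcases h1 with ⟨rfl, rfl⟩ | ⟨rfl, rfl⟩
      · rfl
      · exact upperHalfcircle_comm _ _
    have e2 : upperHalfcircle c d = upperHalfcircle c' d' := by
      rcases h2 with ⟨rfl, rfl⟩ | ⟨rfl, rfl⟩
      · rfl
      · exact upperHalfcircle_comm _ _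
    rw [e1, e2] at h
    constructor
    · rintro ⟨g1, g2, g3⟩
      obtain ⟨x, y, hy, k1, k2⟩ := exists_circle_inter g1 g2 g3
      exact h (a := !₂[x, y]) ⟨hy, k1⟩ ⟨hy, k2⟩
    · rintro ⟨g1, g2, g3⟩
      obtain ⟨x, y, hy, k1, k2⟩ := exists_circle_inter g1 g2 g3
      exact h (a := !₂[x, y]) ⟨hy, k2⟩ ⟨hy, k1⟩

/-- The reflection of the plane in the spine. -/
noncomputable def reflect (z : Plane) : Plane := !₂[z 0, -z 1]

theorem reflect_mem_lower {a b : ℝ} {z : Plane} (h : z ∈ upperHalfcircle a b) :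
    reflect z ∈ lowerHalfcircle a b := by
  obtain ⟨h1, h2⟩ := h
  refine ⟨?_, ?_⟩
  · change -z 1 ≤ 0
    linarith
  · change (z 0 - _) ^ 2 + (-z 1) ^ 2 = _
    rw [neg_sq]; exact h2

theorem parity_of_disjoint_lower {a b c d : ℝ}
    (h : Disjoint (lowerHalfcircle a b) (lowerHalfcircle c d)) :
    leftOf a c + leftOf b c + leftOf a d + leftOf b d = 0 := by
  apply parity_of_disjoint_upper
  rw [Set.disjoint_left] at h ⊢
  exact fun z h1 h2 => h (reflect_mem_lower h1) (reflect_mem_lower h2)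

/-! ### Even pairs and the complete graph on five vertices. -/

/-- The parity condition satisfied by two non-crossing connections, one from `u` to `v` and one
from `p` to `q`; `L` and `M` count modulo two the lower arcs of the connections over a point. -/
def EvenPair (u v : ℝ) (L : ℝ → ZMod 2) (p q : ℝ) (M : ℝ → ZMod 2) : Prop :=
  leftOf u p + leftOf v p + leftOf u q + leftOf v q + L p + L q + M u + M v = 0

theorem EvenPair.flip_left {u v p q : ℝ} {L M : ℝ → ZMod 2} (h : EvenPair u v L p q M) :
    EvenPair v u L p q M := by
  unfold EvenPair at *
  linear_combination h

theorem EvenPair.flip_right {u v p q : ℝ} {L M : ℝ → ZMod 2} (h : EvenPair u v L p q M) :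
    EvenPair u v L q p M := by
  unfold EvenPair at *
  linear_combination h

theorem EvenPair.zero_left (u p q : ℝ) (M : ℝ → ZMod 2) : EvenPair u u 0 p q M := by
  unfold EvenPair
  have h2 : (2 : ZMod 2) = 0 := by decide
  simp only [Pi.zero_apply]
  linear_combination (leftOf u p + leftOf u q + M u) * h2

theorem EvenPair.zero_right (u v p : ℝ) (L : ℝ → ZMod 2) : EvenPair u v L p p 0 := by
  unfold EvenPair
  have h2 : (2 : ZMod 2) = 0 := by decide
  simp only [Pi.zero_apply]
  linear_combination (leftOf u p + leftOf v p + L p) * h2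

/-- All terms at the intermediate point `v` occur twice and cancel modulo two. -/
theorem EvenPair.add_left {u v w p q : ℝ} {L L' M : ℝ → ZMod 2} (h : EvenPair u v L p q M)
    (h' : EvenPair v w L' p q M) : EvenPair u w (L + L') p q M := by
  unfold EvenPair at *
  have h2 : (2 : ZMod 2) = 0 := by decide
  simp only [Pi.add_apply]
  linear_combination h + h' - (leftOf v p + leftOf v q + M v) * h2

theorem EvenPair.add_right {u v p q r : ℝ} {L M M' : ℝ → ZMod 2} (h : EvenPair u v L p q M)
    (h' : EvenPair u v L q r M') : EvenPair u v L p r (M + M') := by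
  unfold EvenPair at *
  have h2 : (2 : ZMod 2) = 0 := by decide
  simp only [Pi.add_apply]
  linear_combination h + h' - (leftOf u q + leftOf v q + L q) * h2

/-- Disjoint edges, each made of an upper and a lower halfcircle, form an even pair. -/
theorem evenPair_of_disjoint {a x b p y q : ℝ}
    (h : Disjoint (upperHalfcircle a x ∪ lowerHalfcircle x b)
      (upperHalfcircle p y ∪ lowerHalfcircle y q)) :
    EvenPair a b (fun z => leftOf x z + leftOf b z) p q (fun z => leftOf y z + leftOf q z) := by
  have hu := parity_of_disjoint_upper
    (h.mono Set.subset_union_left Set.subset_union_left)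
  have hl := parity_of_disjoint_lower
    (h.mono Set.subset_union_right Set.subset_union_right)
  rw [Set.disjoint_left] at h
  have hay : a ≠ y := by
    rintro rfl
    exact h (a := !₂[a, 0]) (.inl (mem_upperHalfcircle_left _ _ rfl rfl))
      (.inl (mem_upperHalfcircle_right _ _ rfl rfl))
  have haq : a ≠ q := by
    rintro rfl
    exact h (a := !₂[a, 0]) (.inl (mem_upperHalfcircle_left _ _ rfl rfl))
      (.inr (mem_lowerHalfcircle_right _ _ rfl rfl))
  have hby : b ≠ y := by
    rintro rfl
    exact h (a := !₂[b, 0]) (.inr (mem_lowerHalfcircle_right _ _ rfl rfl))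
      (.inl (mem_upperHalfcircle_right _ _ rfl rfl))
  have hbq : b ≠ q := by
    rintro rfl
    exact h (a := !₂[b, 0]) (.inr (mem_lowerHalfcircle_right _ _ rfl rfl))
      (.inr (mem_lowerHalfcircle_right _ _ rfl rfl))
  have e1 := leftOf_swap hay
  have e2 := leftOf_swap haq
  have e3 := leftOf_swap hby
  have e4 := leftOf_swap hbq
  unfold EvenPair
  have h2 : (2 : ZMod 2) = 0 := by decide
  simp only
  -- The term comparing the two joints, `leftOf x y`, occurs in both `hu` and `hl` and cancels. This
  -- is why joints enter only through `L` and `M`.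
  linear_combination hu + hl + e1 + e2 + e3 + e4 + (leftOf b p + leftOf b q  + 2
    - leftOf x y + leftOf a q) * h2

/-- There is no drawing of the complete graph on five vertices in which all pairs of independent
edges are even. -/
theorem not_evenPair_completeGraph {a b c v w : ℝ}
    (hab : a ≠ b) (hac : a ≠ c) (hbc : b ≠ c) (hav : a ≠ v) (hbv : b ≠ v) (hcv : c ≠ v)
    (haw : a ≠ w) (hbw : b ≠ w) (hcw : c ≠ w) (hvw : v ≠ w)
    {Lab Lac Lbc Lva Lvb Lvc Lwa Lwb Lwc Lvw : ℝ → ZMod 2}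
    (h1 : EvenPair v w Lvw a b Lab) (h2 : EvenPair v w Lvw a c Lac)
    (h3 : EvenPair v w Lvw b c Lbc)
    (h4 : EvenPair v a Lva b c Lbc) (h5 : EvenPair v b Lvb a c Lac)
    (h6 : EvenPair v c Lvc a b Lab)
    (h7 : EvenPair w a Lwa b c Lbc) (h8 : EvenPair w b Lwb a c Lac)
    (h9 : EvenPair w c Lwc a b Lab)
    (h10 : EvenPair v a Lva w b Lwb) (h11 : EvenPair v a Lva w c Lwc)
    (h12 : EvenPair v b Lvb w a Lwa) (h13 : EvenPair v b Lvb w c Lwc)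
    (h14 : EvenPair v c Lvc w a Lwa) (h15 : EvenPair v c Lvc w b Lwb) : False := by
  have e1 := leftOf_swap hab
  have e2 := leftOf_swap hac
  have e3 := leftOf_swap hbc
  have e4 := leftOf_swap hav
  have e5 := leftOf_swap hbv
  have e6 := leftOf_swap hcv
  have e7 := leftOf_swap haw
  have e8 := leftOf_swap hbw
  have e9 := leftOf_swap hcw
  have e10 := leftOf_swap hvw
  unfold EvenPair at *
  -- In the sum, every value of a function `L` at a vertex occurs twice. Every pair of vertices is
  -- compared six times; with the chosen orders, both directions occur an odd number of times
  -- exactly for the pairs inside `{a, b, c}`. Each of these contributes `1`, in total `3 = 1`.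
  have h : (0 : ZMod 2) = 1 := by
    linear_combination (norm := (ring_nf; reduce_mod_char))
      h1 + h2 + h3 + h4 + h5 + h6 + h7 + h8 + h9 + h10 + h11 + h12 + h13 + h14 + h15
      + e1 + e2 + e3
  exact absurd h (by decide)

/-! ### From edges to paths: excluding a minor. -/

/-- The graph obtained by adding the edge `vw` to `G` has the complete graph on five vertices as a
minor: `a`, `b`, `c` are a triangle, and the disjoint sets `A` and `B` contain `v` and `w`, are
connected from there, and both see `a`, `b` and `c`. -/
def Obstruction {V : Type*} (G : SimpleGraph V) (v w : V) : Prop :=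
  ∃ (a b c : V) (A B : Set V), G.Adj a b ∧ G.Adj a c ∧ G.Adj b c ∧
    v ∈ A ∧ w ∈ B ∧ Disjoint A B ∧ (∀ y ∈ ({a, b, c} : Set V), y ∉ A ∧ y ∉ B ∧
      (∃ s ∈ A, G.Adj s y ∧ Relation.ReflTransGen (fun s t => G.Adj s t ∧ t ∈ A) v s) ∧
      (∃ s ∈ B, G.Adj s y ∧ Relation.ReflTransGen (fun s t => G.Adj s t ∧ t ∈ B) w s))

theorem Obstruction.symm {V : Type*} {G : SimpleGraph V} {v w : V} (h : Obstruction G v w) :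
    Obstruction G w v := by
  obtain ⟨a, b, c, A, B, hab, hac, hbc, hv, hw, hd, h⟩ := h
  exact ⟨a, b, c, B, A, hab, hac, hbc, hw, hv, hd.symm, fun y hy =>
    ⟨(h y hy).2.1, (h y hy).1, (h y hy).2.2.2, (h y hy).2.2.1⟩⟩

section parity

variable {V : Type*} {G : SimpleGraph V} {X : V → ℝ} {L : Sym2 V → ℝ → ZMod 2}

/-- A path in `S` behaves like an edge with respect to the pairs that are even with all edges
inside `S`. -/
theorem exists_parity_of_path {S : Set V} {u v : V} (hu : u ∈ S)
    (h : Relation.ReflTransGen (fun s t => G.Adj s t ∧ t ∈ S) u v) :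
    v ∈ S ∧ ∃ M : ℝ → ZMod 2,
      (∀ p q N, (∀ a ∈ S, ∀ b ∈ S, G.Adj a b → EvenPair (X a) (X b) (L s(a, b)) p q N) →
        EvenPair (X u) (X v) M p q N) ∧
      (∀ p q N, (∀ a ∈ S, ∀ b ∈ S, G.Adj a b → EvenPair p q N (X a) (X b) (L s(a, b))) →
        EvenPair p q N (X u) (X v) M) := by
  induction h with
  | refl => exact ⟨hu, 0, fun p q N _ => EvenPair.zero_left _ _ _ _,
      fun p q N _ => EvenPair.zero_right _ _ _ _⟩
  | tail _ hst ih =>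
    obtain ⟨hs, M, h1, h2⟩ := ih
    -- The function attached to a path is the sum of the functions of its edges.
    exact ⟨hst.2, _, fun p q N h => (h1 p q N h).add_left (h _ hs _ hst.2 hst.1),
      fun p q N h => (h2 p q N h).add_right (h _ hs _ hst.2 hst.1)⟩

/-- Paths through `A` from `v` and through `B` from `w` to the triangle play the role of the missing
edges of a complete graph on `a, b, c, v, w`. The edge `vw` is the virtual one, with function `0`,
that is, without a lower part. -/
theorem Obstruction.false {v w : V} (h : Obstruction G v w) (hX : Function.Injective X)
    (hL : ∀ u v p q, G.Adj u v → G.Adj p q → u ≠ p → u ≠ q → v ≠ p → v ≠ q →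
      EvenPair (X u) (X v) (L s(u, v)) (X p) (X q) (L s(p, q)))
    (hvw : ∀ p q, G.Adj p q → v ≠ p → v ≠ q → w ≠ p → w ≠ q →
      EvenPair (X v) (X w) 0 (X p) (X q) (L s(p, q))) : False := by
  obtain ⟨a, b, c, A, B, hab, hac, hbc, hv, hw, hd, h⟩ := h
  rw [Set.disjoint_left] at hd
  have conn : ∀ (S : Set V) (u y : V), u ∈ S →
      (∃ s ∈ S, G.Adj s y ∧ Relation.ReflTransGen (fun s t => G.Adj s t ∧ t ∈ S) u s) →
      ∃ M : ℝ → ZMod 2,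
        (∀ p q N, (∀ a ∈ insert y S, ∀ b ∈ insert y S, G.Adj a b →
          EvenPair (X a) (X b) (L s(a, b)) p q N) → EvenPair (X u) (X y) M p q N) ∧
        (∀ p q N, (∀ a ∈ insert y S, ∀ b ∈ insert y S, G.Adj a b →
          EvenPair p q N (X a) (X b) (L s(a, b))) → EvenPair p q N (X u) (X y) M) := by
    rintro S u y hu ⟨s, hs, hsy, hus⟩
    refine (exists_parity_of_path (S := insert y S) (Set.mem_insert_of_mem _ hu)
      (Relation.ReflTransGen.tail ?_ ⟨hsy, Set.mem_insert _ _⟩)).2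
    exact Relation.ReflTransGen.mono (fun s t h => ⟨h.1, Set.mem_insert_of_mem _ h.2⟩) _ _ hus
  obtain ⟨haA, haB, hsa, hta⟩ := h a (by simp)
  obtain ⟨hbA, hbB, hsb, htb⟩ := h b (by simp)
  obtain ⟨hcA, hcB, hsc, htc⟩ := h c (by simp)
  obtain ⟨Mva, va, -⟩ := conn A v a hv hsa
  obtain ⟨Mvb, vb, -⟩ := conn A v b hv hsb
  obtain ⟨Mvc, vc, -⟩ := conn A v c hv hsc
  obtain ⟨Mwa, wa, wa'⟩ := conn B w a hw hta
  obtain ⟨Mwb, wb, wb'⟩ := conn B w b hw htb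
  obtain ⟨Mwc, wc, wc'⟩ := conn B w c hw htc
  have key : ∀ (S T : Set V) (y z : V), y ≠ z → y ∉ T → z ∉ S → (∀ s ∈ S, s ∉ T) →
      ∀ s ∈ insert y S, ∀ t ∈ insert z T, s ≠ t := by
    rintro S T y z hyz hyT hzS hST s (rfl | hs) t (rfl | ht) rfl
    · exact hyz rfl
    · exact hyT ht
    · exact hzS hs
    · exact hST _ hs ht
  -- A path inside `A ∪ {y}` and one inside `B ∪ {z}` share no vertex, so all their edges are
  -- pairwise independent.
  have cross : ∀ y z, y ≠ z → y ∉ B → z ∉ A → ∀ M M' : ℝ → ZMod 2,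
      (∀ p q N, (∀ a ∈ insert y A, ∀ b ∈ insert y A, G.Adj a b →
          EvenPair (X a) (X b) (L s(a, b)) p q N) → EvenPair (X v) (X y) M p q N) →
      (∀ p q N, (∀ a ∈ insert z B, ∀ b ∈ insert z B, G.Adj a b →
          EvenPair p q N (X a) (X b) (L s(a, b))) → EvenPair p q N (X w) (X z) M') →
      EvenPair (X v) (X y) M (X w) (X z) M' := by
    intro y z hyz hy hz M M' h1 h2
    refine h1 _ _ _ fun s hs t ht hst => h2 _ _ _ fun s' hs' t' ht' hst' => ?_
    have k := key A B y z hyz hy hz fun s h => hd h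
    exact hL _ _ _ _ hst hst' (k _ hs _ hs') (k _ hs _ ht') (k _ ht _ hs') (k _ ht _ ht')
  have side : ∀ (S : Set V) (u x y z : V), y ∉ S → z ∉ S → x ≠ y → x ≠ z → G.Adj y z →
      ∀ M : ℝ → ZMod 2,
      (∀ p q N, (∀ a ∈ insert x S, ∀ b ∈ insert x S, G.Adj a b →
          EvenPair (X a) (X b) (L s(a, b)) p q N) → EvenPair (X u) (X x) M p q N) →
      EvenPair (X u) (X x) M (X y) (X z) (L s(y, z)) := by
    intro S u x y z hy hz hxy hxz hyz M h1
    have k : ∀ s ∈ insert x S, s ≠ y ∧ s ≠ z := by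
      rintro s (rfl | hs)
      · exact ⟨hxy, hxz⟩
      · exact ⟨fun e => hy (e ▸ hs), fun e => hz (e ▸ hs)⟩
    exact h1 _ _ _ fun s hs t ht hst =>
      hL _ _ _ _ hst hyz (k s hs).1 (k s hs).2 (k t ht).1 (k t ht).2
  have ne : ∀ {S : Set V} {x y : V}, x ∉ S → y ∈ S → x ≠ y := fun hx hy e => hx (e ▸ hy)
  have hvwne : v ≠ w := fun e => hd hv (e ▸ hw)
  exact not_evenPair_completeGraph (hX.ne hab.ne) (hX.ne hac.ne) (hX.ne hbc.ne)
    (hX.ne (ne haA hv)) (hX.ne (ne hbA hv)) (hX.ne (ne hcA hv))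
    (hX.ne (ne haB hw)) (hX.ne (ne hbB hw)) (hX.ne (ne hcB hw)) (hX.ne hvwne)
    (hvw a b hab (ne haA hv).symm (ne hbA hv).symm (ne haB hw).symm (ne hbB hw).symm)
    (hvw a c hac (ne haA hv).symm (ne hcA hv).symm (ne haB hw).symm (ne hcB hw).symm)
    (hvw b c hbc (ne hbA hv).symm (ne hcA hv).symm (ne hbB hw).symm (ne hcB hw).symm)
    (side A v a b c hbA hcA hab.ne hac.ne hbc _ va)
    (side A v b a c haA hcA hab.ne' hbc.ne hac _ vb)
    (side A v c a b haA hbA hac.ne' hbc.ne' hab _ vc)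
    (side B w a b c hbB hcB hab.ne hac.ne hbc _ wa)
    (side B w b a c haB hcB hab.ne' hbc.ne hac _ wb)
    (side B w c a b haB hbB hac.ne' hbc.ne' hab _ wc)
    (cross a b hab.ne haB hbA _ _ va wb') (cross a c hac.ne haB hcA _ _ va wc')
    (cross b a hab.ne' hbB haA _ _ vb wa') (cross b c hbc.ne hbB hcA _ _ vb wc')
    (cross c a hac.ne' hcB haA _ _ vc wa') (cross c b hbc.ne' hcB hbA _ _ vc wb')

end parity

/-! ### Gaps on the spine. -/

/-- If `S` has more points than `Q`, then two cyclically consecutive points of `S` are not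
separated by `Q`. -/
theorem exists_gap (S Q : Finset ℝ) (h2 : 2 ≤ S.card) (h : Q.card < S.card) :
    ∃ v ∈ S, ∃ w ∈ S, v < w ∧
      ((∀ z ∈ S ∪ Q, ¬ (v < z ∧ z < w)) ∨ ∀ z ∈ S ∪ Q, v ≤ z ∧ z ≤ w) := by
  have hS : S.Nonempty := Finset.card_pos.1 (by omega)
  -- `f` sends a point to its cyclic predecessor in `S`; the fallback `S.max'` wraps around. A point
  -- of `S` missed by `f` on `Q` has no point of `Q` between itself and its cyclic successor.
  set f : ℝ → ℝ := fun z => if hz : (S.filter (· < z)).Nonempty then (S.filter (· < z)).max' hz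
    else S.max' hS with hf
  obtain ⟨v, hv, hvf⟩ : ∃ v ∈ S, v ∉ Q.image f :=
    Finset.exists_mem_notMem_of_card_lt_card (Finset.card_image_le.trans_lt h)
  have hvf' : ∀ z ∈ Q, f z ≠ v := fun z hz e => hvf (e ▸ Finset.mem_image_of_mem f hz)
  by_cases hmax : (S.filter (v < ·)).Nonempty
  · set w := (S.filter (v < ·)).min' hmax with hw
    have hwS := Finset.mem_filter.1 ((S.filter (v < ·)).min'_mem hmax)
    have hwmin : ∀ s ∈ S, v < s → w ≤ s := fun s hs hvs =>
      Finset.min'_le _ _ (Finset.mem_filter.2 ⟨hs, hvs⟩)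
    refine ⟨v, hv, w, hwS.1, hwS.2, .inl ?_⟩
    rintro z hz ⟨hvz, hzw⟩
    rcases Finset.mem_union.1 hz with hz | hz
    · exact (hwmin z hz hvz).not_gt hzw
    · apply hvf' z hz
      have hne : (S.filter (· < z)).Nonempty := ⟨v, Finset.mem_filter.2 ⟨hv, hvz⟩⟩
      simp only [hf, dif_pos hne]
      apply le_antisymm
      · refine Finset.max'_le _ _ _ fun s hs => ?_
        rw [Finset.mem_filter] at hs
        by_contra hlt
        exact (hwmin s hs.1 (not_le.1 hlt)).not_gt (hs.2.trans hzw)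
      · exact Finset.le_max' _ _ (Finset.mem_filter.2 ⟨hv, hvz⟩)
  · have hle : ∀ s ∈ S, s ≤ v := fun s hs => by
      by_contra hlt
      exact hmax ⟨s, Finset.mem_filter.2 ⟨hs, not_le.1 hlt⟩⟩
    have hvm : S.max' hS = v := le_antisymm (Finset.max'_le _ _ _ hle) (Finset.le_max' _ _ hv)
    have hmin : S.min' hS < v := by
      rw [← hvm]
      exact Finset.min'_lt_max'_of_card _ (by omega)
    refine ⟨_, S.min'_mem hS, v, hv, hmin, .inr ?_⟩
    intro z hz
    rcases Finset.mem_union.1 hz with hz | hz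
    · exact ⟨Finset.min'_le _ _ hz, hle z hz⟩
    · constructor
      · by_contra hlt
        apply hvf' z hz
        have hne : ¬ (S.filter (· < z)).Nonempty := by
          rintro ⟨s, hs⟩
          rw [Finset.mem_filter] at hs
          exact hlt ((Finset.min'_le _ _ hs.1).trans hs.2.le)
        simp only [hf, dif_neg hne, hvm]
      · by_contra hlt
        apply hvf' z hz
        rw [not_le] at hlt
        have hne : (S.filter (· < z)).Nonempty := ⟨v, Finset.mem_filter.2 ⟨hv, hlt⟩⟩
        simp only [hf, dif_pos hne]
        exact le_antisymm (Finset.max'_le _ _ _ fun s hs => hle s (Finset.mem_filter.1 hs).1)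
          (Finset.le_max' _ _ (Finset.mem_filter.2 ⟨hv, hlt⟩))

/-! ### The counting bound for plane biarc diagrams. -/

/-- A halfcircle of radius zero is a single point, so a proper arc is a biarc whose joint is one of
its endpoints. This gives all edges a uniform shape. -/
theorem upperHalfcircle_eq_union (p q : ℝ) :
    upperHalfcircle p q = upperHalfcircle p q ∪ lowerHalfcircle q q := by
  refine (Set.union_eq_left.2 fun z hz => ?_).symm
  obtain ⟨h0, h1⟩ := lowerHalfcircle_self q hz
  exact mem_upperHalfcircle_right p q h0 h1

theorem lowerHalfcircle_eq_union (p q : ℝ) :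
    lowerHalfcircle p q = upperHalfcircle p p ∪ lowerHalfcircle p q := by
  refine (Set.union_eq_right.2 fun z hz => ?_).symm
  obtain ⟨h0, h1⟩ := upperHalfcircle_self p hz
  exact mem_lowerHalfcircle_left p q h0 h1

section diagram

variable {V : Type*} {G : SimpleGraph V} {D : Drawing G}

theorem Drawing.IsBiarcDiagram.injective (hB : D.IsBiarcDiagram) :
    Function.Injective fun v => D.point v 0 := by
  intro u v h
  apply D.point_injective
  ext i
  fin_cases i
  · exact h
  · exact (hB.1 u).trans (hB.1 v).symm

/-- Every edge of a biarc diagram is an upper halfcircle followed by a lower halfcircle, one of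
which may be degenerate. -/
theorem Drawing.IsBiarcDiagram.exists_joint (hB : D.IsBiarcDiagram) {e : Sym2 V}
    (he : e ∈ G.edgeSet) :
    ∃ (u v : V) (x : ℝ), e = s(u, v) ∧
      D.arc e = upperHalfcircle (D.point u 0) x ∪ lowerHalfcircle x (D.point v 0) ∧
      (x = D.point u 0 ∨ x = D.point v 0 ∨ e ∈ D.biarcs) := by
  induction e using Sym2.ind with | _ u v =>
  rw [SimpleGraph.mem_edgeSet] at he
  rcases hB.2 u v he with h | h
  · rcases h with h | h
    · exact ⟨u, v, _, rfl, h.trans (upperHalfcircle_eq_union _ _), .inr (.inl rfl)⟩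
    · exact ⟨u, v, _, rfl, h.trans (lowerHalfcircle_eq_union _ _), .inl rfl⟩
  · have hmem : s(u, v) ∈ D.biarcs := ⟨u, v, he, rfl, h⟩
    obtain ⟨x, -, -, h | h⟩ := h
    · exact ⟨u, v, x, rfl, h, .inr (.inr hmem)⟩
    · refine ⟨v, u, x, Sym2.eq_swap, ?_, .inr (.inr hmem)⟩
      rw [h, Set.union_comm, upperHalfcircle_comm, lowerHalfcircle_comm]

/-- A plane biarc diagram has at least as many biarcs and vertices outside of `S` as there are
vertices in `S`, if no two vertices of `S` can be joined by an additional edge. -/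
theorem Drawing.IsPlane.card_le [Fintype V] [DecidableEq V] (hP : D.IsPlane)
    (hB : D.IsBiarcDiagram) (S : Finset V) (h2 : 2 ≤ S.card)
    (hS : ∀ v ∈ S, ∀ w ∈ S, v ≠ w → Obstruction G v w) :
    S.card ≤ Sᶜ.card + D.biarcs.ncard := by
  by_contra hlt
  rw [not_le] at hlt
  set X : V → ℝ := fun v => D.point v 0 with hX
  have hXinj : Function.Injective X := hB.injective
  obtain ⟨v₀, -⟩ : S.Nonempty := Finset.card_pos.1 (by omega)
  have : Nonempty V := ⟨v₀⟩
  choose! a b x hab harc hx using fun e (he : e ∈ G.edgeSet) => hB.exists_joint he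
  set L : Sym2 V → ℝ → ZMod 2 := fun e z => leftOf (x e) z + leftOf (X (b e)) z with hL
  have hfin : D.biarcs.Finite := Set.toFinite _
  -- Only joints of true biarcs have to be added to the vertices outside `S`: the joint of a proper
  -- arc is already the position of a vertex.
  obtain ⟨v', hv', w', hw', hlt', hgap⟩ := exists_gap (S.image X)
    (Sᶜ.image X ∪ hfin.toFinset.image x) (by rwa [Finset.card_image_of_injective _ hXinj]) (by
      rw [Finset.card_image_of_injective _ hXinj]
      refine (Finset.card_union_le _ _).trans_lt (lt_of_le_of_lt ?_ hlt)
      rw [Set.ncard_eq_toFinset_card _ hfin]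
      exact add_le_add Finset.card_image_le Finset.card_image_le)
  obtain ⟨v, hv, rfl⟩ := Finset.mem_image.1 hv'
  obtain ⟨w, hw, rfl⟩ := Finset.mem_image.1 hw'
  have hvw : v ≠ w := fun e => by simp [e] at hlt'
  set T := S.image X ∪ (Sᶜ.image X ∪ hfin.toFinset.image x) with hT
  have hXT : ∀ u, X u ∈ T := fun u => by
    by_cases hu : u ∈ S
    · exact Finset.mem_union_left _ (Finset.mem_image_of_mem _ hu)
    · exact Finset.mem_union_right _ (Finset.mem_union_left _
        (Finset.mem_image_of_mem _ (Finset.mem_compl.2 hu)))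
  have hxT : ∀ e ∈ G.edgeSet, x e ∈ T := fun e he => by
    rcases hx e he with h | h | h
    · rw [h]; exact hXT _
    · rw [h]; exact hXT _
    · exact Finset.mem_union_right _ (Finset.mem_union_right _
        (Finset.mem_image_of_mem _ (hfin.mem_toFinset.2 h)))
  have hx_ne : ∀ e ∈ G.edgeSet, ∀ u, u ∉ e → X u ≠ x e := by
    intro e he u hu hXu
    have hz : D.point u ∈ D.arc e := by
      rw [harc e he]
      exact .inl (mem_upperHalfcircle_right _ _ hXu (hB.1 u))
    have hadj : G.Adj (a e) (b e) := by rw [← SimpleGraph.mem_edgeSet, ← hab e he]; exact he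
    rw [hab e he, Sym2.mem_iff, not_or] at hu
    rw [hab e he] at hz
    exact D.arc_avoids _ _ _ hadj hu.1 hu.2 hz
  have orient_left : ∀ u v, G.Adj u v → ∀ p q N,
      EvenPair (X (a s(u, v))) (X (b s(u, v))) (L s(u, v)) p q N →
      EvenPair (X u) (X v) (L s(u, v)) p q N := by
    intro u v huv p q N h
    rcases Sym2.eq_iff.1 (hab s(u, v) huv) with ⟨h1, h2⟩ | ⟨h1, h2⟩
    · rwa [← h1, ← h2] at h
    · rw [← h1, ← h2] at h
      exact h.flip_left
  have orient_right : ∀ u v, G.Adj u v → ∀ p q N,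
      EvenPair p q N (X (a s(u, v))) (X (b s(u, v))) (L s(u, v)) →
      EvenPair p q N (X u) (X v) (L s(u, v)) := by
    intro u v huv p q N h
    rcases Sym2.eq_iff.1 (hab s(u, v) huv) with ⟨h1, h2⟩ | ⟨h1, h2⟩
    · rwa [← h1, ← h2] at h
    · rw [← h1, ← h2] at h
      exact h.flip_right
  refine (hS v hv w hw hvw).false (X := X) (L := L) hXinj ?_ ?_
  · intro u v p q huv hpq h1 h2 h3 h4
    have he : s(u, v) ∈ G.edgeSet := huv
    have hf : s(p, q) ∈ G.edgeSet := hpq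
    have hdis : Disjoint (D.arc s(u, v)) (D.arc s(p, q)) := by
      rw [Set.disjoint_left]
      intro z hz hz'
      obtain ⟨y, hy, hy', -⟩ := hP _ he _ hf (by
        intro h; rw [Sym2.eq_iff] at h; tauto) z ⟨hz, hz'⟩
      rw [Sym2.mem_iff] at hy hy'
      rcases hy with rfl | rfl <;> tauto
    rw [harc _ he, harc _ hf] at hdis
    exact orient_left u v huv _ _ _ (orient_right p q hpq _ _ _ (evenPair_of_disjoint hdis))
  · intro p q hpq h1 h2 h3 h4
    have he : s(p, q) ∈ G.edgeSet := hpq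
    -- Whether a point of `T` lies between `v` and `w` does not depend on the point: never in an
    -- ordinary gap (`c = 0`), always in the wrap-around gap (`c = 1`). The parity of an edge with
    -- the virtual edge is then a sum of four copies of `c`.
    obtain ⟨c, hc⟩ : ∃ c : ZMod 2, ∀ z ∈ T, X v ≠ z → X w ≠ z →
        leftOf (X v) z + leftOf (X w) z = c ∧ leftOf z (X v) + leftOf z (X w) = c := by
      have e2 : (1 + 1 : ZMod 2) = 0 := by decide
      rcases hgap with hgap | hgap
      · refine ⟨0, fun z hz hzv hzw => ?_⟩
        have := hgap z hz
        unfold leftOf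
        constructor <;> split_ifs <;> first | (simp [e2]; done) | (exfalso; grind)
      · refine ⟨1, fun z hz hzv hzw => ?_⟩
        have := hgap z hz
        unfold leftOf
        constructor <;> split_ifs <;> first | (simp; done) | (exfalso; grind)
    have hnot : ∀ u ∈ s(p, q), u ≠ v ∧ u ≠ w := by
      intro u hu
      rcases Sym2.mem_iff.1 hu with rfl | rfl
      · exact ⟨h1.symm, h3.symm⟩
      · exact ⟨h2.symm, h4.symm⟩
    have ha := hnot (a s(p, q)) (by
      have h := Sym2.mem_mk_left (a s(p, q)) (b s(p, q))
      rwa [← hab _ he] at h)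
    have hb := hnot (b s(p, q)) (by
      have h := Sym2.mem_mk_right (a s(p, q)) (b s(p, q))
      rwa [← hab _ he] at h)
    have ka := hc _ (hXT (a s(p, q))) (hXinj.ne ha.1.symm) (hXinj.ne ha.2.symm)
    have kb := hc _ (hXT (b s(p, q))) (hXinj.ne hb.1.symm) (hXinj.ne hb.2.symm)
    have kx := hc _ (hxT _ he) (hx_ne _ he v fun h => (hnot v h).1 rfl)
      (hx_ne _ he w fun h => (hnot w h).2 rfl)
    apply orient_right p q hpq
    have e2 : (2 : ZMod 2) = 0 := by decide
    unfold EvenPair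
    simp only [Pi.zero_apply, hL]
    linear_combination ka.1 + kb.1 + kx.2 + kb.2 + 2 * c * e2

end diagram

/-! ### A straight-line plane drawing of the host graph. -/

/-- The vertices of an infinite planar graph: two apexes, a path in the common neighbourhood of the
apexes, and tips stacked into the triangles formed by an apex and an edge of the path. -/
inductive Host : Type
  | apex (b : Bool)
  | path (j : ℕ)
  | tip (b : Bool) (j : ℕ)

namespace Host

/-- The arcs of an acyclic orientation of the host graph. -/
def Step : Host → Host → Prop
  | apex a, apex b => a = true ∧ b = false
  | path _, apex _ => True
  | path j, path k => k = j + 1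
  | tip a _, apex b => a = b
  | tip _ j, path k => k = j ∨ k = j + 1
  | _, _ => False

theorem Step.irrefl (u : Host) : ¬ Step u u := by
  cases u with
  | apex b => rintro ⟨h, h'⟩; simp [h] at h'
  | path j => intro h; exact absurd h (by simp [Step])
  | tip b j => exact id

/-- The infinite planar graph. -/
def graph : SimpleGraph Host where
  Adj u v := Step u v ∨ Step v u
  symm := ⟨fun _ _ h => h.symm⟩
  loopless := ⟨fun u h => h.elim (Step.irrefl u) (Step.irrefl u)⟩

/-- The sign of the half-plane that belongs to an apex. -/
noncomputable def sign (b : Bool) : ℝ := if b then 1 else -1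

theorem sign_mul_self (b : Bool) : sign b * sign b = 1 := by cases b <;> simp [sign]

/-- The positions of the vertices in a straight-line drawing. -/
noncomputable def pos : Host → Plane
  | apex b => !₂[0, sign b]
  | path j => !₂[(j : ℝ) + 1, 0]
  -- The centroid of the triangle into which the tip is stacked.
  | tip b j => !₂[(2 * (j : ℝ) + 3) / 3, sign b / 3]

theorem pos_injective : Function.Injective pos := by
  have hs : ∀ b c, sign b = sign c → b = c := by
    intro b c; cases b <;> cases c <;> simp [sign] <;> norm_num
  have hs0 : ∀ b, sign b ≠ 0 := by intro b; cases b <;> simp [sign]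
  intro u v h
  have h0 : pos u 0 = pos v 0 := by rw [h]
  have h1 : pos u 1 = pos v 1 := by rw [h]
  cases u with
  | apex b => cases v with
    | apex c => simp [pos] at h1; rw [hs _ _ h1]
    | path k => simp [pos] at h0; linarith [(Nat.cast_nonneg k : (0 : ℝ) ≤ k)]
    | tip c k => simp [pos] at h0; linarith [(Nat.cast_nonneg k : (0 : ℝ) ≤ k)]
  | path j => cases v with
    | apex c => simp [pos] at h0; linarith [(Nat.cast_nonneg j : (0 : ℝ) ≤ j)]
    | path k => simp [pos] at h0; rw [h0]
    | tip c k => simp [pos] at h1; exact absurd h1.symm (by simpa using hs0 c)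
  | tip b j => cases v with
    | apex c => simp [pos] at h0; linarith [(Nat.cast_nonneg j : (0 : ℝ) ≤ j)]
    | path k => simp [pos] at h1; exact absurd h1 (by simpa using hs0 b)
    | tip c k =>
      simp [pos] at h0 h1
      rw [hs _ _ h1, h0]

/-- The neighbours of the apex `b` on its side, from left to right. -/
def site (b : Bool) (r : ℕ) : Host := if Even r then path (r / 2) else tip b (r / 2)

/-- The distance of a site from the spine. -/
noncomputable def height (r : ℕ) : ℝ := if Even r then 0 else 1 / 3

/-- Central projection from the apex `b` onto the spine sends the site `r` to the abscissa `r / 2 +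
1`. Edges on one side of the spine are compared through this projection. -/
theorem pos_site_zero (b : Bool) (r : ℕ) : pos (site b r) 0 = (1 - height r) * (r / 2 + 1) := by
  unfold site height
  rcases Nat.even_or_odd' r with ⟨k, rfl | rfl⟩
  · simp [pos]
  · have h : ¬ Even (2 * k + 1) := by simp
    have h' : (2 * k + 1) / 2 = k := by omega
    rw [if_neg h, if_neg h, h']
    simp [pos]; ring

theorem pos_site_one (b : Bool) (r : ℕ) : pos (site b r) 1 = sign b * height r := by
  unfold site height
  split_ifs <;> simp [pos, div_eq_mul_inv]

theorem height_cases (r : ℕ) : height r = 0 ∧ height (r + 1) = 1 / 3 ∨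
    height r = 1 / 3 ∧ height (r + 1) = 0 := by
  unfold height
  by_cases h : Even r
  · have h' : ¬ Even (r + 1) := by simp [Nat.even_add_one, h]
    simp [h, h']
  · have h' : Even (r + 1) := by simp [Nat.even_add_one, h]
    simp [h, h']

/-- The straight-line drawing of an edge. -/
noncomputable def edgeArc : Sym2 Host → Set Plane :=
  Sym2.lift ⟨fun u v => segment ℝ (pos u) (pos v), fun _ _ => segment_symm _ _ _⟩

theorem mem_edgeArc {u v : Host} {z : Plane} : z ∈ edgeArc s(u, v) ↔
    ∃ s t : ℝ, 0 ≤ s ∧ 0 ≤ t ∧ s + t = 1 ∧ z 0 = s * pos u 0 + t * pos v 0 ∧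
      z 1 = s * pos u 1 + t * pos v 1 := by
  change z ∈ segment ℝ (pos u) (pos v) ↔ _
  constructor
  · rintro ⟨s, t, hs, ht, hst, rfl⟩
    exact ⟨s, t, hs, ht, hst, by simp, by simp⟩
  · rintro ⟨s, t, hs, ht, hst, h0, h1⟩
    refine ⟨s, t, hs, ht, hst, ?_⟩
    ext i
    fin_cases i
    · simp [h0]
    · simp [h1]

/-- `z` is the position of an endpoint of `e`. -/
def IsEnd (z : Plane) (e : Sym2 Host) : Prop := ∃ v ∈ e, z = pos v

theorem isEnd_of_eq {z : Plane} {v : Host} {e : Sym2 Host} (hv : v ∈ e) (h0 : z 0 = pos v 0)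
    (h1 : z 1 = pos v 1) : IsEnd z e := by
  refine ⟨v, hv, ?_⟩
  ext i
  fin_cases i
  · exact h0
  · exact h1

theorem mem_edgeSet_cases {e : Sym2 Host} (he : e ∈ graph.edgeSet) :
    e = s(apex true, apex false) ∨ (∃ b r, e = s(apex b, site b r)) ∨
      (∃ b r, e = s(site b r, site b (r + 1))) ∨ ∃ j, e = s(path j, path (j + 1)) := by
  have key : ∀ u v, Step u v → s(u, v) = s(apex true, apex false) ∨
      (∃ b r, s(u, v) = s(apex b, site b r)) ∨
      (∃ b r, s(u, v) = s(site b r, site b (r + 1))) ∨ ∃ j, s(u, v) = s(path j, path (j + 1)) := by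
    have heven : ∀ b j, site b (2 * j) = path j := fun b j => by simp [site]
    have hodd : ∀ b j, site b (2 * j + 1) = tip b j := fun b j => by
      have h' : (2 * j + 1) / 2 = j := by omega
      simp [site, h']
    intro u v h
    cases u with
    | apex a => cases v with
      | apex b => obtain ⟨rfl, rfl⟩ := h; exact .inl rfl
      | path k => exact h.elim
      | tip c k => exact h.elim
    | path j => cases v with
      | apex b => exact .inr (.inl ⟨b, 2 * j, by rw [heven, Sym2.eq_swap]⟩)
      | path k => obtain rfl : k = j + 1 := h; exact .inr (.inr (.inr ⟨j, rfl⟩))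
      | tip c k => exact h.elim
    | tip a j => cases v with
      | apex b =>
        obtain rfl : a = b := h
        exact .inr (.inl ⟨a, 2 * j + 1, by rw [hodd, Sym2.eq_swap]⟩)
      | path k =>
        rcases h with rfl | rfl
        · exact .inr (.inr (.inl ⟨a, 2 * k, by rw [hodd, heven, Sym2.eq_swap]⟩))
        · exact .inr (.inr (.inl ⟨a, 2 * j + 1, by
            rw [hodd, show 2 * j + 1 + 1 = 2 * (j + 1) by ring, heven]⟩))
      | tip c k => exact h.elim
  induction e using Sym2.ind with | _ u v =>
  rcases he with h | h
  · exact key u v h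
  · rw [Sym2.eq_swap]; exact key v u h

/-- An edge at an apex has constant projection. It reaches the spine only if it ends at a path
vertex; the integrality of the abscissa is recorded for comparison with path edges in `spine_spec`.
-/
theorem ray_spec {b : Bool} {r : ℕ} {z : Plane} (hz : z ∈ edgeArc s(apex b, site b r)) :
    z 0 = (1 - sign b * z 1) * (r / 2 + 1) ∧ 0 ≤ sign b * z 1 ∧ sign b * z 1 ≤ 1 ∧
      (sign b * z 1 = 1 → IsEnd z s(apex b, site b r)) ∧
      (z 1 = 0 → IsEnd z s(apex b, site b r) ∧ ∃ k : ℕ, z 0 = k + 1) := by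
  obtain ⟨s, t, hs, ht, hst, h0, h1⟩ := mem_edgeArc.1 hz
  rw [pos_site_zero] at h0
  rw [pos_site_one] at h1
  simp only [pos, Matrix.cons_val_zero, Matrix.cons_val_one, Matrix.cons_val_fin_one, mul_zero,
    zero_add] at h0 h1
  have hb := sign_mul_self b
  have hy : sign b * z 1 = s + t * height r := by rw [h1]; linear_combination (s + t * height r) * hb
  have hh : 0 ≤ height r ∧ height r ≤ 1 / 3 := by unfold height; split_ifs <;> norm_num
  obtain rfl : s = 1 - t := by linarith
  refine ⟨?_, ?_, ?_, ?_, ?_⟩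
  · rw [hy, h0]; ring
  · rw [hy]; nlinarith
  · rw [hy]; nlinarith
  · intro h
    have ht0 : t = 0 := by rw [hy] at h; nlinarith
    subst ht0
    refine isEnd_of_eq (Sym2.mem_mk_left _ _) ?_ ?_
    · rw [h0]; simp [pos]
    · rw [h1]; simp [pos]
  · intro h
    rw [h, mul_zero] at hy
    have hth : 0 ≤ t * height r := mul_nonneg ht hh.1
    have ht1 : t = 1 := by linarith
    subst ht1
    have hr : height r = 0 := by linarith
    have hev : Even r := by
      by_contra hne
      simp [height, hne] at hr
    refine ⟨isEnd_of_eq (Sym2.mem_mk_right _ _) ?_ ?_, r / 2, ?_⟩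
    · rw [h0, pos_site_zero]; ring
    · rw [h1, pos_site_one]; ring
    · obtain ⟨k, rfl⟩ := hev
      have e : (k + k) / 2 = k := by omega
      rw [h0, hr, e]; push_cast; ring

/-- The projection of an edge between consecutive sites runs through an interval of length `1 / 2`,
and its extreme values are attained only at the two ends. Different such edges on one side have
intervals with disjoint interiors. -/
theorem zig_spec {b : Bool} {r : ℕ} {z : Plane} (hz : z ∈ edgeArc s(site b r, site b (r + 1))) :
    0 ≤ sign b * z 1 ∧ sign b * z 1 ≤ 1 / 3 ∧ (1 - sign b * z 1) * (r / 2 + 1) ≤ z 0 ∧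
      z 0 ≤ (1 - sign b * z 1) * (r / 2 + 3 / 2) ∧
      (z 0 = (1 - sign b * z 1) * (r / 2 + 1) → z = pos (site b r)) ∧
      (z 0 = (1 - sign b * z 1) * (r / 2 + 3 / 2) → z = pos (site b (r + 1))) ∧
      (z 1 = 0 → IsEnd z s(site b r, site b (r + 1)) ∧ ∃ k : ℕ, z 0 = k + 1) := by
  obtain ⟨s, t, hs, ht, hst, h0, h1⟩ := mem_edgeArc.1 hz
  rw [pos_site_zero, pos_site_zero] at h0
  rw [pos_site_one, pos_site_one] at h1
  push_cast at h0
  have hb := sign_mul_self b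
  have hy : sign b * z 1 = s * height r + t * height (r + 1) := by
    rw [h1]; linear_combination (s * height r + t * height (r + 1)) * hb
  have hc := height_cases r
  obtain rfl : s = 1 - t := by linarith
  have hlo : z 0 - (1 - sign b * z 1) * (r / 2 + 1) = t * (1 - height (r + 1)) / 2 := by
    rw [hy, h0]; ring
  have hhi : (1 - sign b * z 1) * (r / 2 + 3 / 2) - z 0 = (1 - t) * (1 - height r) / 2 := by
    rw [hy, h0]; ring
  have hl : t = 0 → z = pos (site b r) := by
    rintro rfl
    ext i
    fin_cases i
    · simp only [Fin.zero_eta]; rw [h0, pos_site_zero]; ring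
    · simp only [Fin.mk_one]; rw [h1, pos_site_one]; ring
  have hr : t = 1 → z = pos (site b (r + 1)) := by
    rintro rfl
    ext i
    fin_cases i
    · simp only [Fin.zero_eta]; rw [h0, pos_site_zero]; push_cast; ring
    · simp only [Fin.mk_one]; rw [h1, pos_site_one]; ring
  have hint : ∀ q, height q = 0 → ∃ k : ℕ, pos (site b q) 0 = k + 1 := by
    intro q hq
    have hev : Even q := by
      by_contra hne
      simp [height, hne] at hq
    obtain ⟨k, rfl⟩ := hev
    refine ⟨k, ?_⟩
    rw [pos_site_zero, hq]; push_cast; ring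
  refine ⟨?_, ?_, ?_, ?_, ?_, ?_, ?_⟩
  · rw [hy]; rcases hc with ⟨e, e'⟩ | ⟨e, e'⟩ <;> rw [e, e'] <;> linarith
  · rw [hy]; rcases hc with ⟨e, e'⟩ | ⟨e, e'⟩ <;> rw [e, e'] <;> linarith
  · rcases hc with ⟨e, e'⟩ | ⟨e, e'⟩ <;> rw [e'] at hlo <;> linarith
  · rcases hc with ⟨e, e'⟩ | ⟨e, e'⟩ <;> rw [e] at hhi <;> linarith
  · intro h
    apply hl
    rcases hc with ⟨e, e'⟩ | ⟨e, e'⟩ <;> rw [e'] at hlo <;> linarith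
  · intro h
    apply hr
    rcases hc with ⟨e, e'⟩ | ⟨e, e'⟩ <;> rw [e] at hhi <;> linarith
  · intro h
    rw [h, mul_zero] at hy
    rcases hc with ⟨e, e'⟩ | ⟨e, e'⟩
    · have hz := hl (by rw [e, e'] at hy; linarith)
      exact ⟨⟨_, Sym2.mem_mk_left _ _, hz⟩, by rw [hz]; exact hint _ e⟩
    · have hz := hr (by rw [e, e'] at hy; linarith)
      exact ⟨⟨_, Sym2.mem_mk_right _ _, hz⟩, by rw [hz]; exact hint _ e'⟩

theorem spine_spec {j : ℕ} {z : Plane} (hz : z ∈ edgeArc s(path j, path (j + 1))) :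
    z 1 = 0 ∧ (j : ℝ) + 1 ≤ z 0 ∧ z 0 ≤ j + 2 ∧
      ((∃ k : ℕ, z 0 = k + 1) → IsEnd z s(path j, path (j + 1))) := by
  obtain ⟨s, t, hs, ht, hst, h0, h1⟩ := mem_edgeArc.1 hz
  simp only [pos, Matrix.cons_val_zero, Matrix.cons_val_one, Matrix.cons_val_fin_one, mul_zero,
    add_zero] at h0 h1
  push_cast at h0
  obtain rfl : s = 1 - t := by linarith
  have e : z 0 = j + 1 + t := by rw [h0]; ring
  refine ⟨h1, by linarith, by linarith, ?_⟩
  rintro ⟨k, hk⟩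
  have k1 : j ≤ k := by exact_mod_cast (by linarith : (j : ℝ) ≤ k)
  have k2 : k ≤ j + 1 := by exact_mod_cast (by push_cast; linarith : (k : ℝ) ≤ (j + 1 : ℕ))
  obtain rfl | rfl : k = j ∨ k = j + 1 := by omega
  · exact isEnd_of_eq (Sym2.mem_mk_left _ _) (by simp [pos, hk]) (by simp [pos, h1])
  · exact isEnd_of_eq (Sym2.mem_mk_right _ _) (by simp [pos, hk]) (by simp [pos, h1])

theorem core_spec {z : Plane} (hz : z ∈ edgeArc s(apex true, apex false)) : z 0 = 0 := by
  obtain ⟨s, t, hs, ht, hst, h0, h1⟩ := mem_edgeArc.1 hz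
  simpa [pos] using h0

theorem ray_core {b : Bool} {r : ℕ} {z : Plane} (hz : z ∈ edgeArc s(apex b, site b r))
    (h : z 0 = 0) : z = pos (apex b) ∧ IsEnd z s(apex true, apex false) := by
  obtain ⟨h1, h2, h3, h4, h5⟩ := ray_spec hz
  have hr : (0 : ℝ) < r / 2 + 1 := by positivity
  have hy : sign b * z 1 = 1 := by
    rw [h] at h1
    rcases mul_eq_zero.1 h1.symm with h | h <;> linarith
  have hz1 : z 1 = sign b := by linear_combination sign b * hy - z 1 * sign_mul_self b
  have hz' : z = pos (apex b) := by
    ext i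
    fin_cases i
    · simp [pos, h]
    · simp [pos, hz1]
  exact ⟨hz', apex b, by cases b <;> simp, hz'⟩

/-- Different edges of the host graph meet only in common endpoints. -/
theorem isEnd_of_mem {e f : Sym2 Host} (he : e ∈ graph.edgeSet) (hf : f ∈ graph.edgeSet)
    (hne : e ≠ f) {z : Plane} (hze : z ∈ edgeArc e) (hzf : z ∈ edgeArc f) :
    IsEnd z e ∧ IsEnd z f := by
  -- Edges on opposite sides can meet only on the spine, where they have only endpoints.
  have opp : ∀ b c, b ≠ c → 0 ≤ sign b * z 1 → 0 ≤ sign c * z 1 → z 1 = 0 := by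
    intro b c
    cases b <;> cases c <;> simp [sign] <;> intros <;> linarith
  have ray_zig : ∀ b r c q, z ∈ edgeArc s(apex b, site b r) →
      z ∈ edgeArc s(site c q, site c (q + 1)) →
      IsEnd z s(apex b, site b r) ∧ IsEnd z s(site c q, site c (q + 1)) := by
    intro b r c q hr hz
    obtain ⟨r1, r2, r3, r4, r5⟩ := ray_spec hr
    obtain ⟨z1, z2, z3, z4, z5, z6, z7⟩ := zig_spec hz
    by_cases hbc : b = c
    · subst hbc
      have hpos : 0 < 1 - sign b * z 1 := by linarith
      rw [r1] at z3 z4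
      have k1 := le_of_mul_le_mul_left z3 hpos
      have k2 := le_of_mul_le_mul_left z4 hpos
      have l1 : q ≤ r := by exact_mod_cast (by linarith : (q : ℝ) ≤ r)
      have l2 : r ≤ q + 1 := by exact_mod_cast (by push_cast; linarith : (r : ℝ) ≤ (q + 1 : ℕ))
      obtain rfl | rfl : r = q ∨ r = q + 1 := by omega
      · have := z5 r1
        exact ⟨⟨_, Sym2.mem_mk_right _ _, this⟩, _, Sym2.mem_mk_left _ _, this⟩
      · have := z6 (by rw [r1]; push_cast; ring)
        exact ⟨⟨_, Sym2.mem_mk_right _ _, this⟩, _, Sym2.mem_mk_right _ _, this⟩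
    · have h0 := opp b c hbc r2 z1
      exact ⟨(r5 h0).1, (z7 h0).1⟩
  have zig_zig : ∀ b r q, r < q → z ∈ edgeArc s(site b r, site b (r + 1)) →
      z ∈ edgeArc s(site b q, site b (q + 1)) →
      IsEnd z s(site b r, site b (r + 1)) ∧ IsEnd z s(site b q, site b (q + 1)) := by
    intro b r q hrq hr hz
    obtain ⟨r1, r2, r3, r4, r5, r6, r7⟩ := zig_spec hr
    obtain ⟨z1, z2, z3, z4, z5, z6, z7⟩ := zig_spec hz
    have hpos : 0 < 1 - sign b * z 1 := by linarith
    have k1 := le_of_mul_le_mul_left (z3.trans r4) hpos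
    have l1 : q ≤ r + 1 := by exact_mod_cast (by push_cast; linarith : (q : ℝ) ≤ (r + 1 : ℕ))
    obtain rfl : q = r + 1 := by omega
    have hz := z5 (le_antisymm (r4.trans_eq (by push_cast; ring)) z3)
    exact ⟨⟨_, Sym2.mem_mk_right _ _, hz⟩, _, Sym2.mem_mk_left _ _, hz⟩
  have zig_pos : ∀ b r, z ∈ edgeArc s(site b r, site b (r + 1)) → z 0 ≠ 0 := by
    intro b r hr h
    obtain ⟨r1, r2, r3, -⟩ := zig_spec hr
    have hr : (0 : ℝ) < r / 2 + 1 := by positivity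
    have := mul_pos (show 0 < 1 - sign b * z 1 by linarith) hr
    linarith
  have spine_pos : ∀ j, z ∈ edgeArc s(path j, path (j + 1)) → z 0 ≠ 0 := by
    intro j hj h
    obtain ⟨-, h1, -⟩ := spine_spec hj
    linarith [(Nat.cast_nonneg j : (0 : ℝ) ≤ j)]
  have ray_spine : ∀ b r j, z ∈ edgeArc s(apex b, site b r) →
      z ∈ edgeArc s(path j, path (j + 1)) →
      IsEnd z s(apex b, site b r) ∧ IsEnd z s(path j, path (j + 1)) := by
    intro b r j hr hj
    obtain ⟨-, -, -, -, r5⟩ := ray_spec hr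
    obtain ⟨s1, -, -, s4⟩ := spine_spec hj
    exact ⟨(r5 s1).1, s4 (r5 s1).2⟩
  have zig_spine : ∀ b r j, z ∈ edgeArc s(site b r, site b (r + 1)) →
      z ∈ edgeArc s(path j, path (j + 1)) →
      IsEnd z s(site b r, site b (r + 1)) ∧ IsEnd z s(path j, path (j + 1)) := by
    intro b r j hr hj
    obtain ⟨-, -, -, -, -, -, r5⟩ := zig_spec hr
    obtain ⟨s1, -, -, s4⟩ := spine_spec hj
    exact ⟨(r5 s1).1, s4 (r5 s1).2⟩
  have ray_core' : ∀ b r, z ∈ edgeArc s(apex b, site b r) →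
      z ∈ edgeArc s(apex true, apex false) →
      IsEnd z s(apex b, site b r) ∧ IsEnd z s(apex true, apex false) := by
    intro b r hr hc
    obtain ⟨h1, h2⟩ := ray_core hr (core_spec hc)
    exact ⟨⟨_, Sym2.mem_mk_left _ _, h1⟩, h2⟩
  rcases mem_edgeSet_cases he with rfl | ⟨b, r, rfl⟩ | ⟨b, r, rfl⟩ | ⟨j, rfl⟩ <;>
    rcases mem_edgeSet_cases hf with rfl | ⟨c, q, rfl⟩ | ⟨c, q, rfl⟩ | ⟨k, rfl⟩
  · exact absurd rfl hne
  · exact (ray_core' c q hzf hze).symm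
  · exact absurd (core_spec hze) (zig_pos _ _ hzf)
  · exact absurd (core_spec hze) (spine_pos _ hzf)
  · exact ray_core' _ _ hze hzf
  · obtain ⟨r1, r2, r3, r4, r5⟩ := ray_spec hze
    obtain ⟨q1, q2, q3, q4, q5⟩ := ray_spec hzf
    by_cases hbc : b = c
    · subst hbc
      -- Away from the apex, equal projections mean equal rays.
      have h : (1 - sign b * z 1) * ((r : ℝ) - q) = 0 := by linear_combination 2 * q1 - 2 * r1
      rcases mul_eq_zero.1 h with h | h
      · exact ⟨r4 (by linarith), q4 (by linarith)⟩
      · exact absurd (by rw [Nat.cast_injective (sub_eq_zero.1 h)]) hne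
    · have h0 := opp b c hbc r2 q2
      exact ⟨(r5 h0).1, (q5 h0).1⟩
  · exact ray_zig _ _ _ _ hze hzf
  · exact ray_spine _ _ _ hze hzf
  · exact absurd (core_spec hzf) (zig_pos _ _ hze)
  · exact (ray_zig _ _ _ _ hzf hze).symm
  · by_cases hbc : b = c
    · subst hbc
      rcases lt_trichotomy r q with h | rfl | h
      · exact zig_zig _ _ _ h hze hzf
      · exact absurd rfl hne
      · exact (zig_zig _ _ _ h hzf hze).symm
    · obtain ⟨r1, -, -, -, -, -, r7⟩ := zig_spec hze
      obtain ⟨q1, -, -, -, -, -, q7⟩ := zig_spec hzf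
      have h0 := opp b c hbc r1 q1
      exact ⟨(r7 h0).1, (q7 h0).1⟩
  · exact zig_spine _ _ _ hze hzf
  · exact absurd (core_spec hzf) (spine_pos _ hze)
  · exact (ray_spine _ _ _ hzf hze).symm
  · exact (zig_spine _ _ _ hzf hze).symm
  · obtain ⟨-, j2, j3, j4⟩ := spine_spec hze
    obtain ⟨-, k2, k3, k4⟩ := spine_spec hzf
    have l1 : j ≤ k + 1 := by exact_mod_cast (by push_cast; linarith : (j : ℝ) ≤ (k + 1 : ℕ))
    have l2 : k ≤ j + 1 := by exact_mod_cast (by push_cast; linarith : (k : ℝ) ≤ (j + 1 : ℕ))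
    have hjk : j ≠ k := fun h => hne (by rw [h])
    obtain rfl | rfl : j = k + 1 ∨ k = j + 1 := by omega
    · have : ∃ m : ℕ, z 0 = m + 1 := ⟨k + 1, by push_cast at *; linarith⟩
      exact ⟨j4 this, k4 this⟩
    · have : ∃ m : ℕ, z 0 = m + 1 := ⟨j + 1, by push_cast at *; linarith⟩
      exact ⟨j4 this, k4 this⟩

theorem isPlanarGraph : IsPlanarGraph graph := by
  -- Since no vertex is isolated, avoidance of vertices reduces to the statement on pairs of edges:
  -- a vertex on a foreign edge would lie on two different edges.
  have hadj : ∀ w, ∃ w', graph.Adj w w' := by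
    intro w
    cases w with
    | apex b => exact ⟨path 0, .inr trivial⟩
    | path j => exact ⟨apex true, .inl trivial⟩
    | tip b j => exact ⟨apex b, .inl rfl⟩
  have hend : ∀ {w e}, IsEnd (pos w) e → w ∈ e := by
    rintro w e ⟨v, hv, h⟩
    rwa [pos_injective h]
  refine ⟨⟨pos, edgeArc, pos_injective, fun u v huv => ⟨Path.segment _ _, ?_, ?_⟩, ?_⟩, ?_⟩
  · exact Path.segment_injective_of_ne (pos_injective.ne huv.ne)
  · exact Path.range_segment _ _
  · intro u v w huv hwu hwv hw
    obtain ⟨w', hw'⟩ := hadj w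
    have hwe : w ∉ s(u, v) := by simp [hwu, hwv]
    have hne : s(u, v) ≠ s(w, w') := fun h => hwe (h ▸ Sym2.mem_mk_left _ _)
    exact hwe (hend (isEnd_of_mem huv hw' hne hw (left_mem_segment _ _ _)).1)
  · rintro e he f hf hne z ⟨hze, hzf⟩
    obtain ⟨⟨v, hv, hzv⟩, ⟨w, hw, hzw⟩⟩ := isEnd_of_mem he hf hne hze hzf
    have : v = w := pos_injective (hzv.symm.trans hzw)
    exact ⟨v, hv, this ▸ hw, hzv⟩

end Host

/-! ### Restricting and relabelling drawings. -/

/-- The drawing of a graph that is obtained from a drawing of a larger graph. -/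
def Drawing.comap {V W : Type*} {G : SimpleGraph V} {H : SimpleGraph W} (D : Drawing H)
    (f : V → W) (hf : Function.Injective f) (hom : ∀ u v, G.Adj u v → H.Adj (f u) (f v)) :
    Drawing G where
  point v := D.point (f v)
  arc e := D.arc (e.map f)
  point_injective := D.point_injective.comp hf
  arc_isJordanArc u v h := D.arc_isJordanArc _ _ (hom u v h)
  arc_avoids u v _ h hu hv := D.arc_avoids _ _ _ (hom u v h) (hf.ne hu) (hf.ne hv)

section comap

variable {V W : Type*} {G : SimpleGraph V} {H : SimpleGraph W} {D : Drawing H}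
  {f : V → W} {hf : Function.Injective f} {hom : ∀ u v, G.Adj u v → H.Adj (f u) (f v)}

theorem Drawing.IsPlane.comap (hD : D.IsPlane) : (D.comap f hf hom).IsPlane := by
  have hmem : ∀ e ∈ G.edgeSet, e.map f ∈ H.edgeSet := by
    intro e he
    induction e using Sym2.ind with | _ u v => exact hom u v he
  intro e he g hg hne z hz
  obtain ⟨v, hv, hv', rfl⟩ := hD _ (hmem e he) _ (hmem g hg) ((Sym2.map.injective hf).ne hne) z hz
  obtain ⟨w, hw, rfl⟩ := Sym2.mem_map.1 hv
  obtain ⟨w', hw', h⟩ := Sym2.mem_map.1 hv'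
  exact ⟨w, hw, hf h ▸ hw', rfl⟩

theorem Drawing.IsBiarcDiagram.comap (hD : D.IsBiarcDiagram) :
    (D.comap f hf hom).IsBiarcDiagram :=
  ⟨fun v => hD.1 (f v), fun u v h => hD.2 _ _ (hom u v h)⟩

theorem Drawing.ncard_biarcs_comap_le [Finite W] :
    (D.comap f hf hom).biarcs.ncard ≤ D.biarcs.ncard := by
  refine Set.ncard_le_ncard_of_injOn (Sym2.map f) ?_ (Sym2.map.injective hf).injOn
    (Set.toFinite _)
  rintro _ ⟨u, v, huv, rfl, h⟩
  exact ⟨f u, f v, hom u v huv, rfl, h⟩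

end comap

/-! ### The stacked triangulations. -/

/-- The vertices of the `i`-th graph: two apexes, a path and tips. -/
abbrev StackVertex (i : ℕ) : Type := Bool ⊕ Fin (i + 4) ⊕ (Bool × Fin (i + 1))

namespace StackVertex

variable {i : ℕ}

/-- The embedding of the vertices into the infinite planar graph. -/
def toHost : StackVertex i → Host
  | .inl b => .apex b
  | .inr (.inl j) => .path j
  -- The shift leaves the first edge of the path without tips, and the range of `j` leaves out the
  -- last one: the two end vertices of the path are themselves stacked vertices.
  | .inr (.inr (b, j)) => .tip b (j + 1)

theorem toHost_injective : Function.Injective (toHost (i := i)) := by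
  rintro (b | j | ⟨b, j⟩) (c | k | ⟨c, k⟩) h <;> simp [toHost, Fin.ext_iff] at h ⊢ <;> exact h

/-- The graph with few vertices other than those in a large independent set. -/
def graph (i : ℕ) : SimpleGraph (StackVertex i) := Host.graph.comap toHost

theorem isPlanarGraph (i : ℕ) : IsPlanarGraph (graph i) := by
  obtain ⟨D, hD⟩ := Host.isPlanarGraph
  exact ⟨D.comap toHost toHost_injective fun _ _ h => h, hD.comap⟩

theorem ncard_edgeSet (i : ℕ) : (graph i).edgeSet.ncard = 9 * i + 18 := by
  -- The edges by type: the apex edge, path to apex, path edges, and three edges at every tip. The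
  -- total is `1 + 2(i + 4) + (i + 3) + 6(i + 1)`.
  let g : Unit ⊕ (Bool × Fin (i + 4)) ⊕ Fin (i + 3) ⊕ (Bool × Fin (i + 1)) ⊕
      (Bool × Fin (i + 1)) ⊕ (Bool × Fin (i + 1)) → StackVertex i × StackVertex i
    | .inl _ => (.inl true, .inl false)
    | .inr (.inl (b, j)) => (.inr (.inl j), .inl b)
    | .inr (.inr (.inl j)) => (.inr (.inl j.castSucc), .inr (.inl j.succ))
    | .inr (.inr (.inr (.inl (b, j)))) => (.inr (.inr (b, j)), .inl b)
    | .inr (.inr (.inr (.inr (.inl (b, j))))) =>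
      (.inr (.inr (b, j)), .inr (.inl ⟨j + 1, by omega⟩))
    | .inr (.inr (.inr (.inr (.inr (b, j))))) =>
      (.inr (.inr (b, j)), .inr (.inl ⟨j + 2, by omega⟩))
  have hg : Function.Injective fun x => s((g x).1, (g x).2) := by
    rintro (_ | ⟨b, j⟩ | j | ⟨b, j⟩ | ⟨b, j⟩ | ⟨b, j⟩)
      (_ | ⟨c, k⟩ | k | ⟨c, k⟩ | ⟨c, k⟩ | ⟨c, k⟩) h <;>
      simp [g, Fin.ext_iff] at h ⊢ <;> grind
  have hr : Set.range (fun x => s((g x).1, (g x).2)) = (graph i).edgeSet := by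
    ext e
    constructor
    · rintro ⟨_ | ⟨b, j⟩ | j | ⟨b, j⟩ | ⟨b, j⟩ | ⟨b, j⟩, rfl⟩ <;> left <;>
        simp [g, toHost, Host.Step]
    · have key : ∀ u v : StackVertex i, Host.Step u.toHost v.toHost →
          s(u, v) ∈ Set.range (fun x => s((g x).1, (g x).2)) := by
        rintro (b | j | ⟨b, j⟩) (c | k | ⟨c, k⟩) h
        · obtain ⟨rfl, rfl⟩ := h
          exact ⟨.inl (), rfl⟩
        · exact h.elim
        · exact h.elim
        · exact ⟨.inr (.inl (c, j)), rfl⟩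
        · have h : (k : ℕ) = j + 1 := h
          refine ⟨.inr (.inr (.inl ⟨j, by omega⟩)), ?_⟩
          simp only [g]
          congr 4
          exact Fin.ext h.symm
        · exact h.elim
        · obtain rfl : b = c := h
          exact ⟨.inr (.inr (.inr (.inl (b, j)))), rfl⟩
        · have h : (k : ℕ) = j + 1 ∨ (k : ℕ) = j + 1 + 1 := h
          rcases h with h | h
          · have hk : k = ⟨j + 1, by omega⟩ := Fin.ext h
            rw [hk]
            exact ⟨.inr (.inr (.inr (.inr (.inl (b, j))))), rfl⟩
          · have hk : k = ⟨j + 2, by omega⟩ := Fin.ext h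
            rw [hk]
            exact ⟨.inr (.inr (.inr (.inr (.inr (b, j))))), rfl⟩
        · exact h.elim
      induction e using Sym2.ind with | _ u v =>
      rintro (h | h)
      · exact key u v h
      · rw [Sym2.eq_swap]; exact key v u h
  rw [← hr, ← Set.image_univ, Set.ncard_image_of_injective _ hg, Set.ncard_univ,
    Nat.card_eq_fintype_card]
  simp
  ring

/-- The `j`-th vertex of the path. -/
abbrev path (j : ℕ) (hj : j < i + 4) : StackVertex i := .inr (.inl ⟨j, hj⟩)

theorem adj_path {j : ℕ} (hj : j + 1 < i + 4) :
    (graph i).Adj (path (j + 1) hj) (path j (by omega)) := .inr rfl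

theorem adj_path_apex {j : ℕ} (hj : j < i + 4) (b : Bool) :
    (graph i).Adj (path j hj) (.inl b) := .inl trivial

/-- The vertices outside of the triangle formed by the apexes and a vertex of the path cannot be
joined across that triangle. -/
theorem obstruction_of_lt {m n : ℕ} (hmn : m < n) (hn : n + 1 < i + 4) {v w : StackVertex i}
    (hv : v = path m (by omega) ∨ ∃ b j, v = .inr (.inr (b, j)) ∧ (j : ℕ) + 1 = m)
    (hw : w = path (n + 1) hn ∨ ∃ b j, w = .inr (.inr (b, j)) ∧ (j : ℕ) + 1 = n) :
    Obstruction (graph i) v w := by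
  -- The triangle of the apexes and `path (m + 1)` separates `v` from `w`. Just before it, `path m`
  -- sees all three corners; beyond it, the rest of the path connects `w` to them.
  refine ⟨.inl true, .inl false, path (m + 1) (by omega), {v, path m (by omega)},
    {x | x = w ∨ ∃ (k : ℕ) (hk : k < i + 4), m + 1 < k ∧ x = path k hk}, .inl ⟨rfl, rfl⟩,
    .inr trivial, .inr trivial, by simp, .inl rfl, ?_, ?_⟩
  · rw [Set.disjoint_left]
    rintro x (rfl | rfl) (h | ⟨k, hk, hmk, h⟩)
    · rcases hv with rfl | ⟨b, j, rfl, hj⟩ <;> rcases hw with rfl | ⟨c, k, rfl, hk⟩ <;>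
        simp at h <;> grind
    · rcases hv with rfl | ⟨b, j, rfl, hj⟩ <;> simp at h
      omega
    · rcases hw with rfl | ⟨c, k, rfl, hk⟩ <;> simp at h
      omega
    · simp at h
      omega
  · have hvm : Relation.ReflTransGen (fun s t => (graph i).Adj s t ∧
        t ∈ ({v, path m (by omega)} : Set (StackVertex i))) v (path m (by omega)) := by
      rcases hv with rfl | ⟨b, j, rfl, rfl⟩
      · exact .refl
      · exact .single ⟨.inl (.inl rfl), .inr rfl⟩
    set B : Set (StackVertex i) :=
      {x | x = w ∨ ∃ (k : ℕ) (hk : k < i + 4), m + 1 < k ∧ x = path k hk} with hB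
    have hwn : Relation.ReflTransGen (fun s t => (graph i).Adj s t ∧ t ∈ B) w (path (n + 1) hn) := by
      rcases hw with rfl | ⟨b, j, rfl, rfl⟩
      · exact .refl
      · exact .single ⟨.inl (.inr rfl), .inr ⟨_, hn, by omega, rfl⟩⟩
    have hwm : ∀ k (hk : m + 2 + k ≤ n + 1), Relation.ReflTransGen
        (fun s t => (graph i).Adj s t ∧ t ∈ B) (path (m + 2 + k) (by omega))
        (path (m + 2) (by omega)) := by
      intro k
      induction k with
      | zero => exact fun _ => .refl
      | succ k ih =>
        intro hk
        exact .head ⟨adj_path _, .inr ⟨m + 2 + k, by omega, by omega, rfl⟩⟩ (ih (by omega))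
    have hwm' := hwm (n - m - 1) (by omega)
    simp only [show m + 2 + (n - m - 1) = n + 1 by omega] at hwm'
    rintro y (rfl | rfl | rfl)
    · refine ⟨?_, ?_, ⟨_, .inr rfl, adj_path_apex _ _, hvm⟩,
        ⟨_, .inr ⟨_, hn, by omega, rfl⟩, adj_path_apex _ _, hwn⟩⟩
      · rcases hv with rfl | ⟨b, j, rfl, hj⟩ <;> simp
      · rcases hw with rfl | ⟨b, j, rfl, hj⟩ <;> simp [hB]
    · refine ⟨?_, ?_, ⟨_, .inr rfl, adj_path_apex _ _, hvm⟩,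
        ⟨_, .inr ⟨_, hn, by omega, rfl⟩, adj_path_apex _ _, hwn⟩⟩
      · rcases hv with rfl | ⟨b, j, rfl, hj⟩ <;> simp
      · rcases hw with rfl | ⟨b, j, rfl, hj⟩ <;> simp [hB]
    · refine ⟨?_, ?_, ⟨_, .inr rfl, (adj_path _).symm, hvm⟩,
        ⟨_, .inr ⟨m + 2, by omega, by omega, rfl⟩, adj_path _, hwn.trans hwm'⟩⟩
      · rcases hv with rfl | ⟨b, j, rfl, hj⟩ <;> simp
      · rcases hw with rfl | ⟨b, j, rfl, hj⟩ <;> (simp [hB]; try omega)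

/-- Two tips over the same path edge lie on different sides of the triangle formed by that edge and
one apex. The tip on the far side reaches this apex through the other apex, so the two are merged.
-/
theorem obstruction_tips (j : Fin (i + 1)) :
    Obstruction (graph i) (.inr (.inr (true, j))) (.inr (.inr (false, j))) := by
  refine ⟨.inl true, path (j + 1) (by omega), path (j + 2) (by omega), {.inr (.inr (true, j))},
    {.inr (.inr (false, j)), .inl false}, .inr trivial, .inr trivial, .inl rfl, rfl, .inl rfl,
    by simp, ?_⟩
  rintro y (rfl | rfl | rfl)
  · exact ⟨by simp, by simp, ⟨_, rfl, .inl rfl, .refl⟩,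
      ⟨.inl false, .inr rfl, .inr ⟨rfl, rfl⟩, .single ⟨.inl rfl, .inr rfl⟩⟩⟩
  · exact ⟨by simp, by simp, ⟨_, rfl, .inl (.inl rfl), .refl⟩,
      ⟨_, .inl rfl, .inl (.inl rfl), .refl⟩⟩
  · exact ⟨by simp, by simp, ⟨_, rfl, .inl (.inr rfl), .refl⟩,
      ⟨_, .inl rfl, .inl (.inr rfl), .refl⟩⟩

/-- The vertices stacked into the faces of the triangulation formed by the apexes and the inner
vertices of the path. -/
def stacked (i : ℕ) : Finset (StackVertex i) :=
  insert (.inr (.inl 0)) (insert (.inr (.inl (Fin.last (i + 3))))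
    (Finset.univ.image fun t => .inr (.inr t)))

theorem card_stacked (i : ℕ) : (stacked i).card = 2 * i + 4 := by
  unfold stacked
  rw [Finset.card_insert_of_notMem, Finset.card_insert_of_notMem, Finset.card_image_of_injective]
  · simp; ring
  · exact fun a b h => by simpa using h
  · simp
  · simp [Fin.ext_iff]

theorem obstruction_of_mem_stacked {v w : StackVertex i} (hv : v ∈ stacked i) (hw : w ∈ stacked i)
    (hvw : v ≠ w) : Obstruction (graph i) v w := by
  simp only [stacked, Finset.mem_insert, Finset.mem_image, Finset.mem_univ, true_and] at hv hw
  rcases hv with rfl | rfl | ⟨⟨b, j⟩, rfl⟩ <;> rcases hw with rfl | rfl | ⟨⟨c, k⟩, rfl⟩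
  · exact absurd rfl hvw
  · exact obstruction_of_lt (m := 0) (n := i + 2) (by omega) (by omega) (.inl rfl) (.inl rfl)
  · exact obstruction_of_lt (m := 0) (n := k + 1) (by omega) (by omega) (.inl rfl)
      (.inr ⟨c, k, rfl, rfl⟩)
  · exact (obstruction_of_lt (m := 0) (n := i + 2) (by omega) (by omega) (.inl rfl)
      (.inl rfl)).symm
  · exact absurd rfl hvw
  · exact (obstruction_of_lt (m := k + 1) (n := i + 2) (by omega) (by omega)
      (.inr ⟨c, k, rfl, rfl⟩) (.inl rfl)).symm
  · exact (obstruction_of_lt (m := 0) (n := j + 1) (by omega) (by omega) (.inl rfl)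
      (.inr ⟨b, j, rfl, rfl⟩)).symm
  · exact obstruction_of_lt (m := j + 1) (n := i + 2) (by omega) (by omega)
      (.inr ⟨b, j, rfl, rfl⟩) (.inl rfl)
  · rcases lt_trichotomy j k with h | rfl | h
    · exact obstruction_of_lt (m := j + 1) (n := k + 1) (by omega) (by omega)
        (.inr ⟨b, j, rfl, rfl⟩) (.inr ⟨c, k, rfl, rfl⟩)
    · cases b <;> cases c
      · exact absurd rfl hvw
      · exact (obstruction_tips j).symm
      · exact obstruction_tips j
      · exact absurd rfl hvw
    · exact (obstruction_of_lt (m := k + 1) (n := j + 1) (by omega) (by omega)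
        (.inr ⟨c, k, rfl, rfl⟩) (.inr ⟨b, j, rfl, rfl⟩)).symm

theorem card_eq (i : ℕ) : Fintype.card (StackVertex i) = 3 * i + 8 := by
  simp; ring

theorem le_ncard_biarcs {D : Drawing (graph i)} (hP : D.IsPlane) (hB : D.IsBiarcDiagram) :
    i ≤ D.biarcs.ncard := by
  have h := hP.card_le hB (stacked i) (by rw [card_stacked]; omega)
    fun v hv w hw hvw => obstruction_of_mem_stacked hv hw hvw
  rw [Finset.card_compl, card_stacked, card_eq] at h
  omega

end StackVertex

/-! ### Transfer to the vertex set `Fin (3 * i + 8)`. -/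

theorem corollary8 (i : ℕ) :
    ∃ G : SimpleGraph (Fin (3 * i + 8)), IsMaximalPlanar G ∧
      ¬ ∃ D : Drawing G, D.IsPlane ∧ D.IsBiarcDiagram ∧ D.biarcs.ncard < i := by
  let e : Fin (3 * i + 8) ≃ StackVertex i :=
    (Fintype.equivFinOfCardEq (StackVertex.card_eq i)).symm
  let φ : (StackVertex.graph i).comap e ≃g StackVertex.graph i :=
    SimpleGraph.Iso.comap e (StackVertex.graph i)
  refine ⟨(StackVertex.graph i).comap e, ⟨?_, ?_⟩, ?_⟩
  · obtain ⟨D, hD⟩ := StackVertex.isPlanarGraph i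
    exact ⟨D.comap e e.injective fun _ _ h => h, hD.comap⟩
  · rw [← Nat.card_coe_set_eq, Nat.card_congr φ.mapEdgeSet, Nat.card_coe_set_eq,
      StackVertex.ncard_edgeSet]
    simp only [Nat.card_eq_fintype_card, Fintype.card_fin]
    ring
  · rintro ⟨D, hP, hB, hlt⟩
    have hom : ∀ u v, (StackVertex.graph i).Adj u v →
        ((StackVertex.graph i).comap e).Adj (e.symm u) (e.symm v) := by
      intro u v h
      simpa using h
    have h := StackVertex.le_ncard_biarcs (hP.comap (hf := e.symm.injective) (hom := hom)) hB.comap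
    exact absurd (h.trans Drawing.ncard_biarcs_comap_le) (not_le.2 hlt)
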